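/- Let $n\ge 1$ and $k\ge 0$, let $\mathbf f:\mathbb R^n\times\mathbb R^k\times[0,\infty)\to\mathbb R^n$ and $\mathbf u:\mathbb R^n\times[0,\infty)\to\mathbb R^k$, and suppose that the closed-loop vector field $\mathbf g(\mathbf x,t)=\mathbf f(\mathbf x,\mathbf u(\mathbf x,t),t)$ is continuously differentiable on $\mathbb R^n\times[0,\infty)$. Consider the system $\dot{\mathbf x}=\mathbf g(\mathbf x,t)$; a trajectory from time $t_0\ge 0$ is a solution on $[t_0,\infty)$. Let $\boldsymbol\Theta:\mathbb R^n\times[0,\infty)\to\mathbb R^{n\times n}$ be continuously differentiable, and suppose that the metric $\mathbf M=\boldsymbol\Theta^T\boldsymbol\Theta$ is uniformly positive definite: there is $m>0$ with $\mathbf M(\mathbf x,t)\ge m\mathbf I$ for all $\mathbf x\in\mathbb R^n$, $t\ge0$ (in particular $\boldsymbol\Theta(\mathbf x,t)$ is invertible). Let $$\mathbf F=\Bigl(\dot{\boldsymbol\Theta}+\boldsymbol\Theta\frac{\partial\mathbf g}{\partial\mathbf x}\Bigr)\boldsymbol\Theta^{-1},\qquad \dot{\boldsymbol\Theta}=\frac{\partial\boldsymbol\Theta}{\partial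 t}+\sum_i\frac{\partial\boldsymbol\Theta}{\partial x_i}g_i ,$$ and suppose that there is $\lambda>0$ with $\tfrac12(\mathbf F+\mathbf F^T)\le-\lambda\mathbf I$ for all $\mathbf x\in\mathbb R^n$, $t\ge 0$. Put $$\rho=\sup_{\mathbf x\in\mathbb R^n,\,t\ge 0}\lambda_{\max}\bigl(\tfrac12(\mathbf F+\mathbf F^T)(\mathbf x,t)\bigr).$$ Then $\rho\le-\lambda<0$, and all trajectories converge globally and exponentially, at rate $|\rho|\ge\lambda$, to a single trajectory, regardless of the initial conditions. Precisely: 1. for every $t_0\ge0$ and $\mathbf x_0\in\mathbb R^n$ there is a trajectory $\mathbf x$ on $[t_0,\infty)$ with $\mathbf x(t_0)=\mathbf x_0$; 2. there is a trajectory $\mathbf x_*$ on $[0,\infty)$ such that for every $t_0\ge 0$ and every trajectory $\mathbf x$ on $[t_0,\infty)$ there is a constant $C$ with $\|\mathbf x(t)-\mathbf x_*(t)\|\le C e^{\rho(t-t_0)}$ for all $t\ge t_0$; 3. any two trajectories $\mathbf x,\mathbf y$ on $[t_0,\infty)$, $t_0\ge0$, satisfy $$\|\mathbf x(t)-\mathbf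 y(t)\|\le \frac{1}{\sqrt m}\,R_{t_0}\bigl(\mathbf x(t_0),\mathbf y(t_0)\bigr)\,e^{\rho(t-t_0)}\qquad(t\ge t_0),$$ where $R_t(\mathbf a,\mathbf b)$ is the infimum of the lengths $\int_0^1\|\boldsymbol\Theta(\gamma(s),t)\gamma'(s)\|\,ds$ of the $C^1$ paths $\gamma$ from $\mathbf a$ to $\mathbf b$. Here $\|\cdot\|$ is the Euclidean norm, and $\le$ between symmetric matrices is the Loewner order. -/

import Mathlib

open scoped ContDiff

noncomputable section

namespace Contraction

/-- The state space `ℝⁿ` with its Euclidean norm and inner product. -/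
abbrev E (n : ℕ) : Type := EuclideanSpace ℝ (Fin n)

/-- The space-time domain `ℝⁿ × [0, ∞)`. -/
def domain (n : ℕ) : Set (E n × ℝ) := Set.univ ×ˢ Set.Ici (0 : ℝ)

/-- The closed-loop vector field `(x, t) ↦ f(x, u(x, t), t)`. -/
def closedLoop {n k : ℕ} (f : E n → E k → ℝ → E n) (u : E n → ℝ → E k) :
    E n → ℝ → E n :=
  fun x t => f x (u x t) t

/-- `x` restricted to `[t₀, ∞)` is a solution of `ẋ = g(x, t)`
(one-sided derivative at the initial time). -/
def IsTrajectory {n : ℕ} (g : E n → ℝ → E n) (t₀ : ℝ) (x : ℝ → E n) : Prop :=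
  ∀ t, t₀ ≤ t → HasDerivWithinAt x (g (x t) t) (Set.Ici t₀) t

/-- The metric `M(x, t) = Θ(x, t)ᵀ Θ(x, t)`. -/
def metric {n : ℕ} (Θ : E n → ℝ → (E n →L[ℝ] E n)) (x : E n) (t : ℝ) : E n →L[ℝ] E n :=
  (ContinuousLinearMap.adjoint (Θ x t)).comp (Θ x t)

/-- The derivative `Θ̇(x, t)` of `Θ` along the system, that is
`∂Θ/∂t + ∑ᵢ (∂Θ/∂xᵢ) gᵢ(x, t)`; the time derivative is one-sided at `t = 0`. -/
def dotTheta {n : ℕ} (g : E n → ℝ → E n) (Θ : E n → ℝ → (E n →L[ℝ] E n))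
    (x : E n) (t : ℝ) : E n →L[ℝ] E n :=
  fderivWithin ℝ (fun p : E n × ℝ => Θ p.1 p.2) (domain n) (x, t) (g x t, 1)

/-- The generalized Jacobian `F = (Θ̇ + Θ ∂g/∂x) Θ⁻¹`. -/
def genJacobian {n : ℕ} (g : E n → ℝ → E n) (Θ : E n → ℝ → (E n →L[ℝ] E n))
    (x : E n) (t : ℝ) : E n →L[ℝ] E n :=
  (dotTheta g Θ x t + (Θ x t).comp (fderiv ℝ (fun y => g y t) x)).comp (Θ x t).inverse

/-- The symmetric part `(A + Aᵀ) / 2`. -/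
def symPart {n : ℕ} (A : E n →L[ℝ] E n) : E n →L[ℝ] E n :=
  (1 / 2 : ℝ) • (A + ContinuousLinearMap.adjoint A)

/-- The largest eigenvalue of a (symmetric) operator. -/
def largestEigenvalue {n : ℕ} (A : E n →L[ℝ] E n) : ℝ :=
  sSup {c : ℝ | Module.End.HasEigenvalue (A : E n →ₗ[ℝ] E n) c}

/-- The supremum over `ℝⁿ × [0, ∞)` of the largest eigenvalue of the symmetric part of `F`. -/
def convergenceExponent {n : ℕ} (g : E n → ℝ → E n) (Θ : E n → ℝ → (E n →L[ℝ] E n)) : ℝ :=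
  ⨆ p : domain n, largestEigenvalue (symPart (genJacobian g Θ p.1.1 p.1.2))

/-- The length `∫ ‖δz‖ = ∫ ‖Θ(x, t) δx‖` of the path `γ` from `γ 0` to `γ 1` at time `t`. -/
def pathLength {n : ℕ} (Θ : E n → ℝ → (E n →L[ℝ] E n)) (t : ℝ) (γ : ℝ → E n) : ℝ :=
  ∫ s in (0 : ℝ)..1, ‖Θ (γ s) t (deriv γ s)‖

/-- The smallest path integral between `a` and `b` at time `t`: the infimum of the lengths of
the continuously differentiable paths from `a` to `b`. -/
def pathDist {n : ℕ} (Θ : E n → ℝ → (E n →L[ℝ] E n)) (t : ℝ) (a b : E n) : ℝ :=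
  sInf {L : ℝ | ∃ γ : ℝ → E n, ContDiff ℝ 1 γ ∧ γ 0 = a ∧ γ 1 = b ∧ L = pathLength Θ t γ}

end Contraction

end

namespace Contraction

open Set Metric Filter Topology
open scoped InnerProductSpace

variable {n : ℕ}

/-! The variational equation gives δz = Θ δx with δz' = F δz, so infinitesimal displacements shrink
at rate ρ in the metric M. The proof works with finite differences instead, so no differentiability
of the flow is needed. For nearby solutions x, y, W = Θ(x, t)(y - x) satisfies W' = F W + Θ r with r
a Taylor remainder. On a compact set ‖Θ r‖ ≤ ε‖W‖ for small y - x, hence decay at rate ρ + ε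
(`exists_norm_theta_sub_le`).

Neither M nor g is bounded above, so existence is part of the problem. A first-exit argument gives
solutions starting near a known one (`exists_solution_near`). Chaining them along a subdivided path
of initial states reaches any state, and the error adds up to the path length
(`exists_solution_of_path`). Thus one solution on an interval gives solutions there from every
state; existence time is uniform in the state, and blow-up is excluded (`exists_isSolutionOn`).
Letting ε → 0 and taking the infimum over paths gives the distance bound. -/

/-! ### Solutions on compact intervals -/

/-- `x` restricted to `[a, b]` is a solution of `ẋ = g(x, t)`. -/
def IsSolutionOn (g : E n → ℝ → E n) (a b : ℝ) (x : ℝ → E n) : Prop :=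
  ∀ t ∈ Icc a b, HasDerivWithinAt x (g (x t) t) (Icc a b) t

lemma IsSolutionOn.continuousOn {g : E n → ℝ → E n} {a b : ℝ} {x : ℝ → E n}
    (hx : IsSolutionOn g a b x) : ContinuousOn x (Icc a b) :=
  fun t ht => (hx t ht).continuousWithinAt

lemma IsSolutionOn.mono {g : E n → ℝ → E n} {a b a' b' : ℝ} {x : ℝ → E n}
    (hx : IsSolutionOn g a b x) (ha : a ≤ a') (hb : b' ≤ b) : IsSolutionOn g a' b' x :=
  fun t ht => (hx t (Icc_subset_Icc ha hb ht)).mono (Icc_subset_Icc ha hb)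

lemma IsSolutionOn.congr {g : E n → ℝ → E n} {a b : ℝ} {x y : ℝ → E n}
    (hx : IsSolutionOn g a b x) (h : EqOn y x (Icc a b)) : IsSolutionOn g a b y := by
  intro t ht
  rw [h ht]
  exact (hx t ht).congr h (h ht)

lemma IsTrajectory.isSolutionOn {g : E n → ℝ → E n} {a : ℝ} {x : ℝ → E n}
    (hx : IsTrajectory g a x) (b : ℝ) : IsSolutionOn g a b x :=
  fun t ht => (hx t ht.1).mono Icc_subset_Ici_self

lemma IsTrajectory.mono {g : E n → ℝ → E n} {a b : ℝ} {x : ℝ → E n}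
    (hx : IsTrajectory g a x) (h : a ≤ b) : IsTrajectory g b x :=
  fun t ht => (hx t (h.trans ht)).mono (Ici_subset_Ici.2 h)

lemma IsSolutionOn.exists_norm_le {g : E n → ℝ → E n} {a b : ℝ} {x : ℝ → E n}
    (hx : IsSolutionOn g a b x) : ∃ C, ∀ t ∈ Icc a b, ‖x t‖ ≤ C :=
  isCompact_Icc.exists_bound_of_continuousOn hx.continuousOn

lemma isTrajectory_of_forall_isSolutionOn {g : E n → ℝ → E n} {a : ℝ} {x : ℝ → E n}
    (hx : ∀ b, IsSolutionOn g a b x) : IsTrajectory g a x := by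
  intro t ht
  have h := hx (t + 1) t ⟨ht, by linarith⟩
  refine h.mono_of_mem_nhdsWithin ?_
  rw [← Ici_inter_Iic]
  exact inter_mem_nhdsWithin _ (Iic_mem_nhds (by linarith))

lemma IsSolutionOn.hasDerivWithinAt_Ici {g : E n → ℝ → E n} {a b : ℝ} {x : ℝ → E n}
    (hx : IsSolutionOn g a b x) {t : ℝ} (ht : t ∈ Ico a b) :
    HasDerivWithinAt x (g (x t) t) (Ici t) t := by
  refine (hx t ⟨ht.1, ht.2.le⟩).mono_of_mem_nhdsWithin ?_
  exact mem_of_superset (Icc_mem_nhdsGE ht.2) (Icc_subset_Icc ht.1 le_rfl)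

/-- Two solutions on consecutive intervals that agree at the common endpoint can be joined. -/
lemma IsSolutionOn.glue {g : E n → ℝ → E n} {a b c : ℝ} {x y : ℝ → E n}
    (hab : a ≤ b) (hbc : b ≤ c)
    (hx : IsSolutionOn g a b x) (hy : IsSolutionOn g b c y) (h : x b = y b) :
    IsSolutionOn g a c (fun t => if t ≤ b then x t else y t) := by
  set z : ℝ → E n := fun t => if t ≤ b then x t else y t
  have hzx : EqOn z x (Icc a b) := fun t ht => if_pos ht.2
  have hzy : EqOn z y (Icc b c) := by
    intro t ht
    rcases ht.1.eq_or_lt with rfl | h'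
    · simp [z, h]
    · simp [z, not_le.2 h']
  have hz1 := hx.congr hzx
  have hz2 := hy.congr hzy
  intro t ht
  rw [← Icc_union_Icc_eq_Icc hab hbc]
  rcases lt_trichotomy t b with h' | h' | h'
  · refine (hz1 t ⟨ht.1, h'.le⟩).union ?_
    -- Away from `b` the other interval does not accumulate at `t`, so its derivative condition is
    -- vacuous.
    refine HasFDerivWithinAt.of_notMem_closure ?_
    rw [closure_Icc]
    exact fun h'' => not_lt.2 h''.1 h'
  · subst h'
    exact (hz1 t ⟨ht.1, le_rfl⟩).union (hz2 t ⟨le_rfl, ht.2⟩)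
  · refine HasDerivWithinAt.union ?_ (hz2 t ⟨h'.le, ht.2⟩)
    refine HasFDerivWithinAt.of_notMem_closure ?_
    rw [closure_Icc]
    exact fun h'' => not_lt.2 h''.2 h'

/-! ### Compactness estimates for C¹ fields -/

lemma uniqueDiffOn_domain : UniqueDiffOn ℝ (domain n) :=
  uniqueDiffOn_univ.prod (uniqueDiffOn_Ici 0)

lemma closedBall_prod_Icc_subset_domain (R T : ℝ) :
    closedBall (0 : E n) R ×ˢ Icc 0 T ⊆ domain n :=
  prod_mono (subset_univ _) Icc_subset_Ici_self

lemma isCompact_closedBall_prod_Icc (R T : ℝ) :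
    IsCompact (closedBall (0 : E n) R ×ˢ Icc (0 : ℝ) T) :=
  (isCompact_closedBall 0 R).prod isCompact_Icc

/-- The slice at a fixed time lies wholly in the domain, so the spatial derivative is unrestricted
even at `t = 0`. -/
lemma hasFDerivAt_section {F : Type*} [NormedAddCommGroup F] [NormedSpace ℝ F]
    {g : E n → ℝ → F}
    (hg : ContDiffOn ℝ 1 (fun p : E n × ℝ => g p.1 p.2) (domain n)) (x : E n) {t : ℝ}
    (ht : 0 ≤ t) :
    HasFDerivAt (fun y => g y t)
      ((fderivWithin ℝ (fun p : E n × ℝ => g p.1 p.2) (domain n) (x, t)).comp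
        (ContinuousLinearMap.inl ℝ (E n) ℝ)) x := by
  have h1 : HasFDerivWithinAt (fun p : E n × ℝ => g p.1 p.2) _ (domain n) (x, t) :=
    ((hg.differentiableOn one_ne_zero) (x, t) ⟨mem_univ _, ht⟩).hasFDerivWithinAt
  have h2 : HasFDerivAt (fun y : E n => (y, t)) (ContinuousLinearMap.inl ℝ (E n) ℝ) x :=
    hasFDerivAt_prodMk_left x t
  have hmaps : MapsTo (fun y : E n => (y, t)) univ (domain n) := fun y _ => ⟨mem_univ _, ht⟩
  exact (h1.comp (s := univ) x h2.hasFDerivWithinAt hmaps).hasFDerivAt univ_mem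

lemma continuousOn_fderiv_section {F : Type*} [NormedAddCommGroup F] [NormedSpace ℝ F]
    {g : E n → ℝ → F}
    (hg : ContDiffOn ℝ 1 (fun p : E n × ℝ => g p.1 p.2) (domain n)) :
    ContinuousOn (fun p : E n × ℝ => fderiv ℝ (fun y => g y p.2) p.1) (domain n) := by
  have h1 := hg.continuousOn_fderivWithin uniqueDiffOn_domain le_rfl
  have h2 : ContinuousOn (fun p : E n × ℝ =>
      (fderivWithin ℝ (fun p : E n × ℝ => g p.1 p.2) (domain n) p).comp
        (ContinuousLinearMap.inl ℝ (E n) ℝ)) (domain n) :=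
    h1.clm_comp continuousOn_const
  exact h2.congr fun p hp => (hasFDerivAt_section hg p.1 hp.2).fderiv

/-- A `C¹` field is Lipschitz in the state on balls, uniformly over compact time intervals. -/
lemma exists_lipschitzOnWith_section {g : E n → ℝ → E n}
    (hg : ContDiffOn ℝ 1 (fun p : E n × ℝ => g p.1 p.2) (domain n)) (R T : ℝ) :
    ∃ K, ∀ t ∈ Icc 0 T, LipschitzOnWith K (fun y => g y t) (closedBall 0 R) := by
  obtain ⟨C, hC⟩ := (isCompact_closedBall_prod_Icc (n := n) R T).exists_bound_of_continuousOn
    ((continuousOn_fderiv_section hg).mono (closedBall_prod_Icc_subset_domain R T))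
  refine ⟨C.toNNReal, fun t ht => ?_⟩
  refine (convex_closedBall _ _).lipschitzOnWith_of_nnnorm_hasFDerivWithin_le
    (f' := fun x => fderiv ℝ (fun y => g y t) x) (fun x _ => ?_) (fun x hx => ?_)
  · exact ((hasFDerivAt_section hg x ht.1).differentiableAt.hasFDerivAt).hasFDerivWithinAt
  · rw [← NNReal.coe_le_coe]
    exact (hC (x, t) ⟨hx, ht⟩).trans (Real.le_coe_toNNReal C)

/-- Uniform first-order Taylor estimate of a `C¹` field on a compact set. -/
lemma exists_forall_taylor_le {g : E n → ℝ → E n}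
    (hg : ContDiffOn ℝ 1 (fun p : E n × ℝ => g p.1 p.2) (domain n)) (R T : ℝ) {η : ℝ}
    (hη : 0 < η) :
    ∃ δ > 0, ∀ t ∈ Icc 0 T, ∀ x ∈ closedBall (0 : E n) R, ∀ y ∈ closedBall (0 : E n) R,
      ‖y - x‖ ≤ δ →
      ‖g y t - g x t - fderiv ℝ (fun z => g z t) x (y - x)‖ ≤ η * ‖y - x‖ := by
  have huc := (isCompact_closedBall_prod_Icc (n := n) R T).uniformContinuousOn_of_continuous
    ((continuousOn_fderiv_section hg).mono (closedBall_prod_Icc_subset_domain R T))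
  obtain ⟨δ, hδ, h⟩ := Metric.uniformContinuousOn_iff_le.1 huc η hη
  refine ⟨δ, hδ, fun t ht x hx y hy hxy => ?_⟩
  -- Mean value inequality on the segment: by uniform continuity, the spatial derivative there stays
  -- within `η` of its value at `x`.
  refine (convex_segment x y).norm_image_sub_le_of_norm_hasFDerivWithin_le'
    (f' := fun z => fderiv ℝ (fun y => g y t) z) (f := fun z => g z t) (fun z _ => ?_)
    (fun z hz => ?_)
    (left_mem_segment ℝ x y) (right_mem_segment ℝ x y)
  · exact ((hasFDerivAt_section hg z ht.1).differentiableAt.hasFDerivAt).hasFDerivWithinAt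
  · have hz' : z ∈ closedBall (0 : E n) R := (convex_closedBall _ _).segment_subset hx hy hz
    rw [← dist_eq_norm]
    refine h (z, t) ⟨hz', ht⟩ (x, t) ⟨hx, ht⟩ ?_
    rw [Prod.dist_eq]
    simp only [dist_self]
    refine max_le ?_ hδ.le
    rw [dist_eq_norm]
    have := norm_sub_le_of_mem_segment hz
    exact this.trans hxy

lemma continuousOn_section_time {F : Type*} [NormedAddCommGroup F] [NormedSpace ℝ F]
    {g : E n → ℝ → F}
    (hg : ContinuousOn (fun p : E n × ℝ => g p.1 p.2) (domain n)) (x : E n) :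
    ContinuousOn (fun t => g x t) (Ici 0) :=
  hg.comp (f := fun t => (x, t)) (by fun_prop) (fun t ht => ⟨mem_univ _, ht⟩)

/-! ### Existence and uniqueness for the differential equation -/

/-- A bounded `C¹` field has solutions on the whole of a compact time interval. -/
lemma exists_isSolutionOn_of_bounded {g : E n → ℝ → E n}
    (hg : ContDiffOn ℝ 1 (fun p : E n × ℝ => g p.1 p.2) (domain n)) {a b t₀ L : ℝ}
    (ha : 0 ≤ a) (ht₀ : t₀ ∈ Icc a b)
    (hL : ∀ x, ∀ t ∈ Icc a b, ‖g x t‖ ≤ L) (x₀ : E n) :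
    ∃ z, z t₀ = x₀ ∧ IsSolutionOn g a b z := by
  have hL0 : 0 ≤ L := (norm_nonneg _).trans (hL 0 t₀ ht₀)
  have hA : 0 ≤ L * (b - a) := mul_nonneg hL0 (by linarith [ht₀.1, ht₀.2])
  -- At speed at most `L` a solution stays within `L * (b - a)` of `x₀`, so a Lipschitz constant on
  -- one ball serves the whole interval.
  obtain ⟨K, hK⟩ := exists_lipschitzOnWith_section hg (‖x₀‖ + L * (b - a)) b
  have hPL : IsPicardLindelof (fun t x => g x t) (tmin := a) (tmax := b) ⟨t₀, ht₀⟩ x₀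
      ⟨L * (b - a), hA⟩ 0 ⟨L, hL0⟩ K := by
    constructor
    · intro t ht
      refine (hK t ⟨ha.trans ht.1, ht.2⟩).mono ?_
      refine closedBall_subset_closedBall' ?_
      rw [dist_zero_right]
      exact (add_comm _ _).le
    · intro x _
      exact (continuousOn_section_time hg.continuousOn x).mono fun t ht => ha.trans ht.1
    · intro t ht x _
      exact hL x t ht
    · show L * max (b - t₀) (t₀ - a) ≤ L * (b - a) - 0
      rw [sub_zero]
      refine mul_le_mul_of_nonneg_left (max_le ?_ ?_) hL0 <;> linarith [ht₀.1, ht₀.2]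
  exact hPL.exists_eq_forall_mem_Icc_hasDerivWithinAt₀

/-- A curve on a whole compact time interval that solves the equation while it is in a ball. -/
lemma exists_solution_in_ball {g : E n → ℝ → E n}
    (hg : ContDiffOn ℝ 1 (fun p : E n × ℝ => g p.1 p.2) (domain n)) {a b t₀ : ℝ}
    (ha : 0 ≤ a) (ht₀ : t₀ ∈ Icc a b) (R : ℝ) (x₀ : E n) :
    ∃ z : ℝ → E n, z t₀ = x₀ ∧ ContinuousOn z (Icc a b) ∧
      ∀ t ∈ Icc a b, ‖z t‖ ≤ R → HasDerivWithinAt z (g (z t) t) (Icc a b) t := by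
  -- The cut-off field is bounded and equals `g` on the ball of radius `R`; `|R|` keeps the radii
  -- positive for every real `R`.
  let φ : ContDiffBump (0 : E n) := ⟨|R| + 1, |R| + 2, by positivity, by linarith⟩
  let h : E n → ℝ → E n := fun x t => φ x • g x t
  have hh : ContDiffOn ℝ 1 (fun p : E n × ℝ => h p.1 p.2) (domain n) := by
    have h1 : ContDiff ℝ 1 (fun p : E n × ℝ => φ p.1) := φ.contDiff.comp contDiff_fst
    exact h1.contDiffOn.smul hg
  obtain ⟨C, hC⟩ := (isCompact_closedBall_prod_Icc (n := n) (|R| + 2) b).exists_bound_of_continuousOn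
    (hg.continuousOn.mono (closedBall_prod_Icc_subset_domain (|R| + 2) b))
  have hb : ∀ x, ∀ t ∈ Icc a b, ‖h x t‖ ≤ max C 0 := by
    intro x t ht
    by_cases hx : x ∈ closedBall (0 : E n) (|R| + 2)
    · have h1 := hC (x, t) ⟨hx, ha.trans ht.1, ht.2⟩
      calc ‖φ x • g x t‖ = φ x * ‖g x t‖ := by
            rw [norm_smul, Real.norm_of_nonneg φ.nonneg]
        _ ≤ 1 * ‖g x t‖ := by gcongr; exact φ.le_one
        _ ≤ max C 0 := by rw [one_mul]; exact h1.trans (le_max_left _ _)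
    · have : φ x = 0 := φ.zero_of_le_dist (by
        rw [mem_closedBall, not_le] at hx; exact hx.le)
      simp [h, this]
  obtain ⟨z, hz0, hz⟩ := exists_isSolutionOn_of_bounded hh ha ht₀ hb x₀
  refine ⟨z, hz0, hz.continuousOn, fun t ht hzt => ?_⟩
  have h1 : φ (z t) = 1 := φ.one_of_mem_closedBall (by
    rw [mem_closedBall, dist_zero_right]
    exact hzt.trans ((le_abs_self R).trans (by simp [φ])))
  have h2 := hz t ht
  simpa [h, h1] using h2

lemma IsSolutionOn.eqOn {g : E n → ℝ → E n}
    (hg : ContDiffOn ℝ 1 (fun p : E n × ℝ => g p.1 p.2) (domain n)) {a b : ℝ} (ha : 0 ≤ a)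
    {x y : ℝ → E n} (hx : IsSolutionOn g a b x) (hy : IsSolutionOn g a b y) (h : x a = y a) :
    EqOn x y (Icc a b) := by
  obtain ⟨C, hC⟩ := hx.exists_norm_le
  obtain ⟨D, hD⟩ := hy.exists_norm_le
  obtain ⟨K, hK⟩ := exists_lipschitzOnWith_section hg (max C D) b
  refine ODE_solution_unique_of_mem_Icc_right (v := fun t x => g x t)
    (s := fun _ => closedBall 0 (max C D))
    (fun t ht => hK t ⟨ha.trans ht.1, ht.2.le⟩) hx.continuousOn
    (fun t ht => hx.hasDerivWithinAt_Ici ht) (fun t ht => ?_) hy.continuousOn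
    (fun t ht => hy.hasDerivWithinAt_Ici ht) (fun t ht => ?_) h
  · rw [mem_closedBall, dist_zero_right]
    exact (hC t ⟨ht.1, ht.2.le⟩).trans (le_max_left _ _)
  · rw [mem_closedBall, dist_zero_right]
    exact (hD t ⟨ht.1, ht.2.le⟩).trans (le_max_right _ _)

/-! ### Contraction hypotheses and quadratic forms -/

/-- The quantitative hypotheses of contraction: `‖Θ v‖ ≥ √m ‖v‖`, and the generalized Jacobian
has numerical range at most `ρ < 0`. -/
structure IsContracting (g : E n → ℝ → E n) (Θ : E n → ℝ → (E n →L[ℝ] E n)) (m ρ : ℝ) :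
    Prop where
  contDiffOn_field : ContDiffOn ℝ 1 (fun p : E n × ℝ => g p.1 p.2) (domain n)
  contDiffOn_theta : ContDiffOn ℝ 1 (fun p : E n × ℝ => Θ p.1 p.2) (domain n)
  m_pos : 0 < m
  rate_neg : ρ < 0
  le_norm_theta : ∀ x t, 0 ≤ t → ∀ v, √m * ‖v‖ ≤ ‖Θ x t v‖
  inner_genJacobian_le : ∀ x t, 0 ≤ t → ∀ w, ⟪w, genJacobian g Θ x t w⟫_ℝ ≤ ρ * ‖w‖ ^ 2

section Algebra

lemma inner_le_of_le_smul_id {A : E n →L[ℝ] E n} {c : ℝ}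
    (h : A ≤ c • ContinuousLinearMap.id ℝ (E n)) (v : E n) : ⟪A v, v⟫_ℝ ≤ c * ‖v‖ ^ 2 := by
  have h1 := (ContinuousLinearMap.le_def _ _ |>.1 h).2 v
  simp only [ContinuousLinearMap.reApplyInnerSelf_apply, sub_apply,
    smul_apply, ContinuousLinearMap.id_apply, inner_sub_left,
    real_inner_smul_left, real_inner_self_eq_norm_sq, RCLike.re_to_real] at h1
  linarith

lemma le_norm_of_smul_id_le_metric {Θ : E n → ℝ → (E n →L[ℝ] E n)} {m : ℝ} (hm : 0 < m)
    {x : E n} {t : ℝ} (h : m • ContinuousLinearMap.id ℝ (E n) ≤ metric Θ x t) (v : E n) :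
    √m * ‖v‖ ≤ ‖Θ x t v‖ := by
  have h1 := (ContinuousLinearMap.le_def _ _ |>.1 h).2 v
  simp only [ContinuousLinearMap.reApplyInnerSelf_apply, sub_apply,
    smul_apply, ContinuousLinearMap.id_apply, inner_sub_left,
    real_inner_smul_left, real_inner_self_eq_norm_sq, RCLike.re_to_real, metric,
    ContinuousLinearMap.comp_apply, ContinuousLinearMap.adjoint_inner_left] at h1
  refine le_of_sq_le_sq ?_ (norm_nonneg _)
  rw [mul_pow, Real.sq_sqrt hm.le]
  linarith

lemma inner_symPart (A : E n →L[ℝ] E n) (v : E n) : ⟪symPart A v, v⟫_ℝ = ⟪v, A v⟫_ℝ := by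
  simp only [symPart, smul_apply, add_apply,
    real_inner_smul_left, inner_add_left, ContinuousLinearMap.adjoint_inner_left]
  rw [real_inner_comm v (A v)]
  ring

lemma isSymmetric_symPart (A : E n →L[ℝ] E n) :
    ((symPart A : E n →L[ℝ] E n) : E n →ₗ[ℝ] E n).IsSymmetric := by
  intro v w
  simp only [symPart, ContinuousLinearMap.coe_coe, smul_apply,
    add_apply, real_inner_smul_left, real_inner_smul_right, inner_add_left,
    inner_add_right, ContinuousLinearMap.adjoint_inner_left,
    ContinuousLinearMap.adjoint_inner_right]
  ring

lemma eigenvalue_le_of_inner_le {A : E n →L[ℝ] E n} {c μ : ℝ}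
    (h : ∀ v, ⟪A v, v⟫_ℝ ≤ c * ‖v‖ ^ 2)
    (hμ : Module.End.HasEigenvalue (A : E n →ₗ[ℝ] E n) μ) : μ ≤ c := by
  obtain ⟨v, hv⟩ := hμ.exists_hasEigenvector
  have h1 : A v = μ • v := hv.apply_eq_smul
  have h2 := h v
  rw [h1, real_inner_smul_left, real_inner_self_eq_norm_sq] at h2
  have h3 : 0 < ‖v‖ ^ 2 := by have := norm_pos_iff.2 hv.2; positivity
  exact le_of_mul_le_mul_right h2 h3

lemma bddAbove_eigenvalues {A : E n →L[ℝ] E n} {c : ℝ} (h : ∀ v, ⟪A v, v⟫_ℝ ≤ c * ‖v‖ ^ 2) :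
    BddAbove {μ : ℝ | Module.End.HasEigenvalue (A : E n →ₗ[ℝ] E n) μ} :=
  ⟨c, fun _ hμ => eigenvalue_le_of_inner_le h hμ⟩

/-- The quadratic form of a symmetric operator is at most its largest eigenvalue. -/
lemma inner_le_largestEigenvalue {A : E n →L[ℝ] E n} {c : ℝ}
    (hA : (A : E n →ₗ[ℝ] E n).IsSymmetric) (h : ∀ v, ⟪A v, v⟫_ℝ ≤ c * ‖v‖ ^ 2) (v : E n) :
    ⟪A v, v⟫_ℝ ≤ largestEigenvalue A * ‖v‖ ^ 2 := by
  rcases eq_or_ne v 0 with rfl | hv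
  · simp
  have : Nontrivial (E n) := ⟨v, 0, hv⟩
  have hpos : ∀ w : E n, w ≠ 0 → 0 < ‖w‖ ^ 2 := fun w hw => by
    have := norm_pos_iff.2 hw; positivity
  have h1 := le_csSup (bddAbove_eigenvalues h) hA.hasEigenvalue_iSup_of_finiteDimensional
  have h2 : ⟪A v, v⟫_ℝ / ‖v‖ ^ 2 ≤
      ⨆ x : { x : E n // x ≠ 0 }, ⟪A (x : E n), (x : E n)⟫_ℝ / ‖(x : E n)‖ ^ 2 := by
    refine le_ciSup (f := fun x : { x : E n // x ≠ 0 } =>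
      ⟪A (x : E n), (x : E n)⟫_ℝ / ‖(x : E n)‖ ^ 2) ⟨c, ?_⟩ ⟨v, hv⟩
    rintro _ ⟨w, rfl⟩
    exact (div_le_iff₀ (hpos w w.2)).2 (h w)
  exact (div_le_iff₀ (hpos v hv)).1 (h2.trans h1)

/-- Positive dimension provides an eigenvalue; without one the supremum would be the default value
0. -/
lemma largestEigenvalue_le (hn : 0 < n) {A : E n →L[ℝ] E n} {c : ℝ}
    (hA : (A : E n →ₗ[ℝ] E n).IsSymmetric) (h : ∀ v, ⟪A v, v⟫_ℝ ≤ c * ‖v‖ ^ 2) :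
    largestEigenvalue A ≤ c := by
  have : Nonempty (Fin n) := ⟨⟨0, hn⟩⟩
  have : Nontrivial (E n) := inferInstance
  exact csSup_le ⟨_, hA.hasEigenvalue_iSup_of_finiteDimensional⟩
    fun μ hμ => eigenvalue_le_of_inner_le h hμ

variable {g : E n → ℝ → E n} {Θ : E n → ℝ → (E n →L[ℝ] E n)} {lam : ℝ}

lemma convergenceExponent_le (hn : 0 < n)
    (hF : ∀ x t, 0 ≤ t → symPart (genJacobian g Θ x t) ≤
      (-lam) • ContinuousLinearMap.id ℝ (E n)) :
    convergenceExponent g Θ ≤ -lam := by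
  have : Nonempty (domain n) := ⟨⟨(0, 0), mem_univ _, self_mem_Ici⟩⟩
  exact ciSup_le fun p => largestEigenvalue_le hn (isSymmetric_symPart _)
    (inner_le_of_le_smul_id (hF p.1.1 p.1.2 p.2.2))

/-- The bound `-lam` makes both real suprema genuine upper bounds, which yields the sharp rate in
place of `-lam`. -/
lemma inner_genJacobian_le_convergenceExponent (hn : 0 < n)
    (hF : ∀ x t, 0 ≤ t → symPart (genJacobian g Θ x t) ≤
      (-lam) • ContinuousLinearMap.id ℝ (E n)) (x : E n) {t : ℝ} (ht : 0 ≤ t) (w : E n) :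
    ⟪w, genJacobian g Θ x t w⟫_ℝ ≤ convergenceExponent g Θ * ‖w‖ ^ 2 := by
  rw [← inner_symPart]
  refine (inner_le_largestEigenvalue (isSymmetric_symPart _)
    (inner_le_of_le_smul_id (hF x t ht)) w).trans ?_
  refine mul_le_mul_of_nonneg_right ?_ (sq_nonneg _)
  refine le_ciSup (f := fun p : domain n =>
    largestEigenvalue (symPart (genJacobian g Θ p.1.1 p.1.2))) ⟨-lam, ?_⟩
    ⟨(x, t), mem_univ _, ht⟩
  rintro _ ⟨p, rfl⟩
  exact largestEigenvalue_le hn (isSymmetric_symPart _)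
    (inner_le_of_le_smul_id (hF p.1.1 p.1.2 p.2.2))

end Algebra

/-! ### Contraction of nearby solutions -/

namespace IsContracting

variable {g : E n → ℝ → E n} {Θ : E n → ℝ → (E n →L[ℝ] E n)} {m ρ : ℝ}

lemma norm_le (H : IsContracting g Θ m ρ) (x : E n) {t : ℝ} (ht : 0 ≤ t) (v : E n) :
    ‖v‖ ≤ (√m)⁻¹ * ‖Θ x t v‖ := by
  rw [inv_mul_eq_div, le_div_iff₀ (Real.sqrt_pos.2 H.m_pos), mul_comm]
  exact H.le_norm_theta x t ht v

/-- Coercivity gives injectivity, hence invertibility in finite dimension, so `inverse` is not its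
default value. -/
lemma inverse_apply_self (H : IsContracting g Θ m ρ) (x : E n) {t : ℝ} (ht : 0 ≤ t) (v : E n) :
    (Θ x t).inverse (Θ x t v) = v := by
  have hinj : Function.Injective (Θ x t : E n →ₗ[ℝ] E n) := by
    rw [← LinearMap.ker_eq_bot, LinearMap.ker_eq_bot']
    intro w hw
    have h := H.norm_le x ht w
    have hw' : Θ x t w = 0 := hw
    rw [hw', norm_zero, mul_zero] at h
    exact norm_le_zero_iff.1 h
  have hinv : (Θ x t).IsInvertible :=
    ⟨(LinearEquiv.ofInjectiveEndo _ hinj).toContinuousLinearEquiv, by ext; rfl⟩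
  exact hinv.inverse_apply_self v

/-- Along two solutions, the weighted difference `Θ(x, t)(y - x)` satisfies an equation. -/
lemma hasDerivWithinAt_theta_sub (H : IsContracting g Θ m ρ) {a b : ℝ} (ha : 0 ≤ a)
    {x y : ℝ → E n} (hx : IsSolutionOn g a b x) (hy : IsSolutionOn g a b y) {t : ℝ}
    (ht : t ∈ Icc a b) :
    HasDerivWithinAt (fun t => Θ (x t) t (y t - x t))
      (dotTheta g Θ (x t) t (y t - x t) + Θ (x t) t (g (y t) t - g (x t) t)) (Icc a b) t := by
  have h1 : HasFDerivWithinAt (fun p : E n × ℝ => Θ p.1 p.2) _ (domain n) (x t, t) :=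
    ((H.contDiffOn_theta.differentiableOn one_ne_zero) (x t, t)
      ⟨mem_univ _, ha.trans ht.1⟩).hasFDerivWithinAt
  have h2 : HasDerivWithinAt (fun s => (x s, s)) (g (x t) t, (1 : ℝ)) (Icc a b) t :=
    (hx t ht).prodMk (hasDerivWithinAt_id t _)
  have hmaps : MapsTo (fun s => (x s, s)) (Icc a b) (domain n) :=
    fun s hs => ⟨mem_univ _, ha.trans hs.1⟩
  have h3 : HasDerivWithinAt (fun s => Θ (x s) s) (dotTheta g Θ (x t) t) (Icc a b) t :=
    HasFDerivWithinAt.comp_hasDerivWithinAt (f := fun s => (x s, s)) t h1 h2 hmaps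
  exact h3.clm_apply ((hy t ht).sub (hx t ht))

/-- Splitting off the linear part of the increment of `g` exposes F acting on the weighted
difference; what remains is the Taylor remainder. -/
lemma theta_sub_deriv_eq (H : IsContracting g Θ m ρ) (x y : E n) {t : ℝ} (ht : 0 ≤ t) :
    dotTheta g Θ x t (y - x) + Θ x t (g y t - g x t) =
      genJacobian g Θ x t (Θ x t (y - x)) +
      Θ x t (g y t - g x t - fderiv ℝ (fun z => g z t) x (y - x)) := by
  simp only [genJacobian, ContinuousLinearMap.comp_apply, add_apply,
    H.inverse_apply_self x ht, map_sub]
  abel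

/-- Nearby solutions approach each other at a rate arbitrarily close to `ρ`. -/
lemma exists_norm_theta_sub_le (H : IsContracting g Θ m ρ) {ε : ℝ} (hε : 0 < ε) (R T : ℝ) :
    ∃ δ > 0, ∀ a b, 0 ≤ a → a ≤ b → b ≤ T → ∀ x y,
      IsSolutionOn g a b x → IsSolutionOn g a b y →
      (∀ t ∈ Icc a b, ‖x t‖ ≤ R ∧ ‖y t‖ ≤ R ∧ ‖y t - x t‖ ≤ δ) →
      ‖Θ (x b) b (y b - x b)‖ ≤
        Real.exp ((ρ + ε) * (b - a)) * ‖Θ (x a) a (y a - x a)‖ := by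
  obtain ⟨C, hC⟩ := (isCompact_closedBall_prod_Icc (n := n) R T).exists_bound_of_continuousOn
    (H.contDiffOn_theta.continuousOn.mono (closedBall_prod_Icc_subset_domain R T))
  have hm := Real.sqrt_pos.2 H.m_pos
  have hC1 : 0 < max C 1 := lt_max_of_lt_right one_pos
  -- This tolerance makes ‖Θ r‖ ≤ ε √m ‖y - x‖ ≤ ε ‖W‖; the maximum with 1 keeps the divisor
  -- positive.
  obtain ⟨δ, hδ, h⟩ := exists_forall_taylor_le H.contDiffOn_field R T
    (η := ε * √m / max C 1) (by positivity)
  refine ⟨δ, hδ, fun a b ha hab hbT x y hx hy hxy => ?_⟩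
  set W : ℝ → E n := fun t => Θ (x t) t (y t - x t) with hWdef
  set W' : ℝ → E n := fun t =>
    dotTheta g Θ (x t) t (y t - x t) + Θ (x t) t (g (y t) t - g (x t) t) with hW'def
  have hW : ∀ t ∈ Icc a b, HasDerivWithinAt W (W' t) (Icc a b) t :=
    fun t ht => H.hasDerivWithinAt_theta_sub ha hx hy ht
  have hinner : ∀ t ∈ Icc a b, ⟪W t, W' t⟫_ℝ ≤ (ρ + ε) * ‖W t‖ ^ 2 := by
    intro t ht
    obtain ⟨hxR, hyR, hd⟩ := hxy t ht
    have ht0 : 0 ≤ t := ha.trans ht.1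
    have htT : t ∈ Icc 0 T := ⟨ht0, ht.2.trans hbT⟩
    have hxb : x t ∈ closedBall (0 : E n) R := mem_closedBall_zero_iff.2 hxR
    have hr := h t htT (x t) hxb (y t) (mem_closedBall_zero_iff.2 hyR) hd
    set r := g (y t) t - g (x t) t - fderiv ℝ (fun z => g z t) (x t) (y t - x t)
    have h1 : ‖Θ (x t) t r‖ ≤ ε * ‖W t‖ := by
      calc ‖Θ (x t) t r‖ ≤ ‖Θ (x t) t‖ * ‖r‖ := (Θ (x t) t).le_opNorm r
        _ ≤ max C 1 * (ε * √m / max C 1 * ‖y t - x t‖) := by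
            gcongr
            exact (hC (x t, t) ⟨hxb, htT⟩).trans (le_max_left _ _)
        _ = ε * (√m * ‖y t - x t‖) := by field_simp
        _ ≤ ε * ‖W t‖ := by
            gcongr
            exact H.le_norm_theta (x t) t ht0 _
    have h2 : W' t = genJacobian g Θ (x t) t (W t) + Θ (x t) t r :=
      H.theta_sub_deriv_eq (x t) (y t) ht0
    rw [h2, inner_add_right]
    have h3 := H.inner_genJacobian_le (x t) t ht0 (W t)
    have h4 : ⟪W t, Θ (x t) t r⟫_ℝ ≤ ‖W t‖ * (ε * ‖W t‖) :=
      (real_inner_le_norm _ _).trans (by gcongr)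
    linarith
  -- Integrating factor for ‖W‖²; the square stays differentiable where W vanishes.
  have hN : ∀ t ∈ Icc a b, HasDerivWithinAt
      (fun t => ‖W t‖ ^ 2 * Real.exp (-2 * (ρ + ε) * (t - a)))
      (2 * ⟪W t, W' t⟫_ℝ * Real.exp (-2 * (ρ + ε) * (t - a)) +
        ‖W t‖ ^ 2 * (Real.exp (-2 * (ρ + ε) * (t - a)) * (-2 * (ρ + ε) * 1)))
      (Icc a b) t := by
    intro t ht
    have h1 : HasDerivWithinAt (fun t => Real.exp (-2 * (ρ + ε) * (t - a)))
        (Real.exp (-2 * (ρ + ε) * (t - a)) * (-2 * (ρ + ε) * 1)) (Icc a b) t :=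
      (((hasDerivAt_id t).sub_const a).const_mul _).exp.hasDerivWithinAt
    exact (hW t ht).norm_sq.mul h1
  have hanti := antitoneOn_of_hasDerivWithinAt_nonpos (convex_Icc a b)
    (fun t ht => (hN t ht).continuousWithinAt)
    (fun t ht => (hN t (interior_subset ht)).mono interior_subset)
    (fun t ht => by
      have h1 := hinner t (interior_subset ht)
      have h2 := Real.exp_pos (-2 * (ρ + ε) * (t - a))
      have h3 := mul_nonneg (sub_nonneg.2 h1) h2.le
      linarith)
  have hfin := hanti (left_mem_Icc.2 hab) (right_mem_Icc.2 hab) hab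
  simp only [sub_self, mul_zero, Real.exp_zero, mul_one] at hfin
  refine le_of_sq_le_sq ?_ (by positivity)
  have he : Real.exp (-2 * (ρ + ε) * (b - a)) * (Real.exp ((ρ + ε) * (b - a))) ^ 2 = 1 := by
    rw [pow_two, ← Real.exp_add, ← Real.exp_add, Real.exp_eq_one_iff]
    ring
  calc ‖W b‖ ^ 2 = ‖W b‖ ^ 2 * Real.exp (-2 * (ρ + ε) * (b - a)) *
        (Real.exp ((ρ + ε) * (b - a))) ^ 2 := by rw [mul_assoc, he, mul_one]
    _ ≤ ‖W a‖ ^ 2 * (Real.exp ((ρ + ε) * (b - a))) ^ 2 := by gcongr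
    _ = (Real.exp ((ρ + ε) * (b - a)) * ‖W a‖) ^ 2 := by ring

/-- Solutions that start close to a given solution exist as long as that one does. -/
lemma exists_solution_near (H : IsContracting g Θ m ρ) {ε : ℝ} (hε : 0 < ε) (hρ : ρ + ε ≤ 0)
    (R T : ℝ) :
    ∃ δ > 0, ∀ a b, 0 ≤ a → a ≤ b → b ≤ T → ∀ x, IsSolutionOn g a b x →
      (∀ t ∈ Icc a b, ‖x t‖ ≤ R) → ∀ y₀, ‖Θ (x a) a (y₀ - x a)‖ < √m * δ →
      ∃ y, y a = y₀ ∧ IsSolutionOn g a b y ∧ ∀ t ∈ Icc a b,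
        ‖Θ (x t) t (y t - x t)‖ ≤
          Real.exp ((ρ + ε) * (t - a)) * ‖Θ (x a) a (y₀ - x a)‖ := by
  obtain ⟨δ', hδ', hpair⟩ := H.exists_norm_theta_sub_le hε (R + 1) T
  have hm := Real.sqrt_pos.2 H.m_pos
  -- The cap 1 keeps `y` in the ball of radius `R + 1`, where the cut-off curve solves the true
  -- equation.
  refine ⟨min δ' 1, lt_min hδ' one_pos, fun a b ha hab hbT x hx hxR y₀ hy₀ => ?_⟩
  set δ := min δ' 1
  obtain ⟨y, hya, hyc, hy⟩ := exists_solution_in_ball H.contDiffOn_field ha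
    (left_mem_Icc.2 hab) (R + 1) y₀
  have hyR : ∀ t ∈ Icc a b, ‖y t - x t‖ ≤ δ → ‖y t‖ ≤ R + 1 := by
    intro t ht hd
    have h1 := norm_le_norm_add_norm_sub' (y t) (x t)
    have h2 : δ ≤ 1 := min_le_right _ _
    linarith [hxR t ht]
  have hest : ∀ c ∈ Icc a b, (∀ t ∈ Icc a c, ‖y t - x t‖ ≤ δ) →
      ‖Θ (x c) c (y c - x c)‖ ≤
        Real.exp ((ρ + ε) * (c - a)) * ‖Θ (x a) a (y₀ - x a)‖ := by
    intro c hc hd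
    have hsub : Icc a c ⊆ Icc a b := Icc_subset_Icc le_rfl hc.2
    rw [← hya]
    refine hpair a c ha hc.1 (hc.2.trans hbT) x y (hx.mono le_rfl hc.2) ?_ ?_
    · exact fun t ht => (hy t (hsub ht) (hyR t (hsub ht) (hd t ht))).mono hsub
    · exact fun t ht => ⟨(hxR t (hsub ht)).trans (by linarith), hyR t (hsub ht) (hd t ht),
        (hd t ht).trans (min_le_left _ _)⟩
  have hlt : ∀ c ∈ Icc a b, (∀ t ∈ Icc a c, ‖y t - x t‖ ≤ δ) → ‖y c - x c‖ < δ := by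
    intro c hc hd
    have h1 := hest c hc hd
    have h2 : Real.exp ((ρ + ε) * (c - a)) ≤ 1 :=
      Real.exp_le_one_iff.2 (mul_nonpos_of_nonpos_of_nonneg hρ (by linarith [hc.1]))
    have h3 := mul_le_of_le_one_left (norm_nonneg (Θ (x a) a (y₀ - x a))) h2
    have h4 := H.le_norm_theta (x c) c (ha.trans hc.1) (y c - x c)
    exact lt_of_mul_lt_mul_left (h4.trans_lt ((h1.trans h3).trans_lt hy₀)) hm.le
  -- First-exit argument: at the first time the distance reaches `δ`, `hlt` still applies and makes
  -- it strictly smaller.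
  have hclose : ∀ t ∈ Icc a b, ‖y t - x t‖ < δ := by
    by_contra! hcon
    obtain ⟨s, hs, hsδ⟩ := hcon
    have hcont : ContinuousOn (fun t => ‖y t - x t‖) (Icc a b) :=
      (hyc.sub hx.continuousOn).norm
    have hcl : IsCompact (Icc a b ∩ (fun t => ‖y t - x t‖) ⁻¹' Ici δ) :=
      isCompact_Icc.of_isClosed_subset
        (hcont.preimage_isClosed_of_isClosed isClosed_Icc isClosed_Ici) inter_subset_left
    obtain ⟨c, ⟨hc, hcδ⟩, hmin⟩ := hcl.exists_isLeast ⟨s, hs, hsδ⟩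
    have hbefore : ∀ t ∈ Ico a c, ‖y t - x t‖ ≤ δ := by
      intro t ht
      by_contra! h
      exact not_le.2 ht.2 (hmin ⟨⟨ht.1, ht.2.le.trans hc.2⟩, h.le⟩)
    have hstart : ‖y a - x a‖ < δ := by
      rw [hya]
      exact lt_of_mul_lt_mul_left ((H.le_norm_theta (x a) a ha _).trans_lt hy₀) hm.le
    have hac : a < c := by
      refine lt_of_le_of_ne hc.1 fun h => ?_
      rw [h] at hstart
      exact not_le.2 hstart hcδ
    have hcle : ‖y c - x c‖ ≤ δ := by
      have h1 : ContinuousOn (fun t => ‖y t - x t‖) (Icc a c) :=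
        hcont.mono (Icc_subset_Icc le_rfl hc.2)
      have h2 : c ∈ closure (Ico a c) := by
        rw [closure_Ico hac.ne]; exact right_mem_Icc.2 hac.le
      have h3 : ContinuousWithinAt (fun t => ‖y t - x t‖) (Ico a c) c :=
        (h1 c (right_mem_Icc.2 hac.le)).mono Ico_subset_Icc_self
      have := mem_closure_iff_nhdsWithin_neBot.1 h2
      exact le_of_tendsto h3 (eventually_of_mem self_mem_nhdsWithin hbefore)
    have h1 := hlt c hc fun t ht => by
      rcases ht.2.eq_or_lt with rfl | h
      · exact hcle
      · exact hbefore t ⟨ht.1, h⟩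
    exact not_le.2 h1 hcδ
  refine ⟨y, hya, fun t ht => hy t ht (hyR t ht (hclose t ht).le), fun t ht => ?_⟩
  exact hest t ht fun s hs => (hclose s ⟨hs.1, hs.2.trans ht.2⟩).le

end IsContracting

/-! ### Transport along paths of initial states -/

/-- Over short parameter intervals the weighted chord of a `C¹` path is at most its weighted
length, up to a relative error, and is small. -/
lemma exists_norm_chord_le {A : ℝ → (E n →L[ℝ] E n)} (hA : Continuous A) {γ : ℝ → E n}
    (hγ : ContDiff ℝ 1 γ) {ε κ : ℝ} (hε : 0 < ε) (hκ : 0 < κ) :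
    ∃ η > 0, ∀ s s', 0 ≤ s → s ≤ s' → s' ≤ 1 → s' - s ≤ η →
      ‖A s (γ s' - γ s)‖ ≤ (∫ r in s..s', ‖A r (deriv γ r)‖) + ε * (s' - s) ∧
      ‖A s (γ s' - γ s)‖ < κ := by
  have hγ' : Continuous (deriv γ) := hγ.continuous_deriv le_rfl
  obtain ⟨C, hC⟩ := isCompact_Icc (a := (0 : ℝ)) (b := 1).exists_bound_of_continuousOn
    hγ'.continuousOn
  have hC0 : 0 < max C 1 := lt_max_of_lt_right one_pos
  -- `η₁` controls the cost of freezing `A` at the left endpoint; `η₂` makes the chord small.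
  obtain ⟨η₁, hη₁, h₁⟩ := Metric.uniformContinuousOn_iff_le.1
    ((isCompact_Icc (a := (0 : ℝ)) (b := 1)).uniformContinuousOn_of_continuous hA.continuousOn)
    (ε / max C 1) (by positivity)
  have hF : Continuous (fun p : ℝ × ℝ => A p.1 (γ p.2 - γ p.1)) := by
    have := hγ.continuous
    fun_prop
  obtain ⟨η₂, hη₂, h₂⟩ := Metric.uniformContinuousOn_iff_le.1
    (((isCompact_Icc (a := (0 : ℝ)) (b := 1)).prod
      (isCompact_Icc (a := (0 : ℝ)) (b := 1))).uniformContinuousOn_of_continuous hF.continuousOn)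
    (κ / 2) (by positivity)
  refine ⟨min η₁ η₂, lt_min hη₁ hη₂, fun s s' hs hss hs' hη => ⟨?_, ?_⟩⟩
  · have hint : ∫ r in s..s', deriv γ r = γ s' - γ s :=
      intervalIntegral.integral_deriv_eq_sub
        (fun r _ => (hγ.differentiable one_ne_zero).differentiableAt)
        (hγ'.intervalIntegrable _ _)
    have hcont : Continuous fun r => ‖A r (deriv γ r)‖ := by fun_prop
    have h3 : A s (γ s' - γ s) = ∫ r in s..s', A s (deriv γ r) := by
      rw [← hint, ← ContinuousLinearMap.intervalIntegral_comp_comm _ (hγ'.intervalIntegrable _ _)]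
    have h4 : ∀ r ∈ Icc s s', ‖A s (deriv γ r)‖ ≤ ‖A r (deriv γ r)‖ + ε := by
      intro r hr
      have hr01 : r ∈ Icc (0 : ℝ) 1 := ⟨hs.trans hr.1, hr.2.trans hs'⟩
      have h5 : ‖A s - A r‖ ≤ ε / max C 1 := by
        rw [← dist_eq_norm]
        refine h₁ s ⟨hs, hss.trans hs'⟩ r hr01 ?_
        rw [dist_comm, Real.dist_eq, abs_of_nonneg (sub_nonneg.2 hr.1)]
        linarith [min_le_left η₁ η₂, hr.2]
      calc ‖A s (deriv γ r)‖ = ‖A r (deriv γ r) + (A s - A r) (deriv γ r)‖ := by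
            simp
        _ ≤ ‖A r (deriv γ r)‖ + ‖(A s - A r) (deriv γ r)‖ := norm_add_le _ _
        _ ≤ ‖A r (deriv γ r)‖ + ε / max C 1 * max C 1 := by
            gcongr
            exact (ContinuousLinearMap.le_opNorm _ _).trans
              (mul_le_mul h5 ((hC r hr01).trans (le_max_left _ _)) (norm_nonneg _)
                (by positivity))
        _ = ‖A r (deriv γ r)‖ + ε := by field_simp
    calc ‖A s (γ s' - γ s)‖ ≤ ∫ r in s..s', ‖A s (deriv γ r)‖ := by
          rw [h3]; exact intervalIntegral.norm_integral_le_integral_norm hss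
      _ ≤ ∫ r in s..s', (‖A r (deriv γ r)‖ + ε) :=
          intervalIntegral.integral_mono_on hss
            (Continuous.intervalIntegrable (by fun_prop) _ _)
            (Continuous.intervalIntegrable (by fun_prop) _ _) h4
      _ = (∫ r in s..s', ‖A r (deriv γ r)‖) + ε * (s' - s) := by
          rw [intervalIntegral.integral_add (hcont.intervalIntegrable _ _)
            intervalIntegrable_const, intervalIntegral.integral_const, smul_eq_mul, mul_comm ε]
  · have hs01 : s ∈ Icc (0 : ℝ) 1 := ⟨hs, hss.trans hs'⟩
    have h3 := h₂ (s, s') ⟨hs01, hs.trans hss, hs'⟩ (s, s) ⟨hs01, hs01⟩ (by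
      rw [Prod.dist_eq]
      simp only [dist_self]
      refine max_le hη₂.le ?_
      rw [Real.dist_eq, abs_of_nonneg (sub_nonneg.2 hss)]
      exact hη.trans (min_le_right _ _))
    simp only [sub_self, map_zero, dist_zero_right] at h3
    linarith

namespace IsContracting

variable {g : E n → ℝ → E n} {Θ : E n → ℝ → (E n →L[ℝ] E n)} {m ρ : ℝ}

/-- Solutions can be transported along a path of initial conditions. -/
lemma exists_solution_of_path (H : IsContracting g Θ m ρ) {ε : ℝ} (hε : 0 < ε)
    (hρ : ρ + ε ≤ 0) {a b : ℝ} (ha : 0 ≤ a) (hab : a ≤ b) {x : ℝ → E n}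
    (hx : IsSolutionOn g a b x) {γ : ℝ → E n} (hγ : ContDiff ℝ 1 γ) (hγ0 : γ 0 = x a) :
    ∃ y, y a = γ 1 ∧ IsSolutionOn g a b y ∧
      ‖x b - y b‖ ≤ (√m)⁻¹ * (Real.exp ((ρ + ε) * (b - a)) * (pathLength Θ a γ + ε)) := by
  obtain ⟨C, hC⟩ := hx.exists_norm_le
  have hm := Real.sqrt_pos.2 H.m_pos
  set A : ℝ → (E n →L[ℝ] E n) := fun s => Θ (γ s) a with hAdef
  have hA : Continuous A := by
    have h1 : ContinuousOn (fun s => (γ s, a)) univ :=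
      (hγ.continuous.prodMk continuous_const).continuousOn
    have hmaps : MapsTo (fun s => (γ s, a)) univ (domain n) := fun s _ => ⟨mem_univ _, ha⟩
    exact continuousOn_univ.1 (H.contDiffOn_theta.continuousOn.comp h1 hmaps)
  have hγ' : Continuous (deriv γ) := hγ.continuous_deriv le_rfl
  have hcont : Continuous fun r => ‖A r (deriv γ r)‖ := by fun_prop
  have hii : ∀ s s', IntervalIntegrable (fun r => ‖A r (deriv γ r)‖) MeasureTheory.volume s s' :=
    fun s s' => hcont.intervalIntegrable s s'
  set ℓ : ℝ → ℝ := fun s => ∫ r in (0 : ℝ)..s, ‖A r (deriv γ r)‖ with hℓ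
  have hℓ_sub : ∀ s s', ℓ s' = ℓ s + ∫ r in s..s', ‖A r (deriv γ r)‖ := fun s s' =>
    (intervalIntegral.integral_add_adjacent_intervals (hii 0 s) (hii s s')).symm
  have hℓ_mono : ∀ s s', s ≤ s' → ℓ s ≤ ℓ s' := fun s s' h => by
    rw [hℓ_sub s s']
    exact le_add_of_nonneg_right
      (intervalIntegral.integral_nonneg h fun _ _ => norm_nonneg _)
  have hℓ1 : ℓ 1 = pathLength Θ a γ := rfl
  have hexp : ∀ t, a ≤ t → Real.exp ((ρ + ε) * (t - a)) ≤ 1 := fun t ht =>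
    Real.exp_le_one_iff.2 (mul_nonpos_of_nonpos_of_nonneg hρ (by linarith))
  -- An a priori bound for all intermediate solutions, independent of the subdivision; hence `δ` can
  -- be fixed before `N`.
  set R := C + (√m)⁻¹ * (ℓ 1 + ε) with hR
  obtain ⟨δ, hδ, hnear⟩ := H.exists_solution_near hε hρ R b
  obtain ⟨η, hη, hchord⟩ := exists_norm_chord_le hA hγ hε (κ := √m * δ) (by positivity)
  obtain ⟨N, hN⟩ := exists_nat_one_div_lt hη
  have hN0 : (0 : ℝ) < N + 1 := by positivity
  have key : ∀ k : ℕ, k ≤ N + 1 → ∃ y, y a = γ (k / (N + 1)) ∧ IsSolutionOn g a b y ∧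
      ∀ t ∈ Icc a b, ‖x t - y t‖ ≤ (√m)⁻¹ *
        (Real.exp ((ρ + ε) * (t - a)) * (ℓ (k / (N + 1)) + ε * (k / (N + 1)))) := by
    intro k
    induction k with
    | zero =>
      intro _
      refine ⟨x, by simp [hγ0], hx, fun t _ => ?_⟩
      simp [hℓ]
    | succ k ih =>
      intro hk
      obtain ⟨y, hya, hy, hyx⟩ := ih (by omega)
      set s : ℝ := k / (N + 1) with hs
      set s' : ℝ := (k + 1 : ℕ) / (N + 1) with hs'
      have hs0 : 0 ≤ s := by positivity
      have hss : s' - s = 1 / (N + 1) := by rw [hs, hs']; push_cast; field_simp; ring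
      have hss0 : 0 < s' - s := by rw [hss]; positivity
      have hs1 : s' ≤ 1 := by
        rw [hs', div_le_one hN0]; exact_mod_cast hk
      obtain ⟨hc1, hc2⟩ := hchord s s' hs0 (by linarith) hs1 (hss ▸ hN.le)
      have hyR : ∀ t ∈ Icc a b, ‖y t‖ ≤ R := by
        intro t ht
        have h1 := norm_le_norm_add_norm_sub (x t) (y t)
        have h2 : ‖x t - y t‖ ≤ (√m)⁻¹ * (ℓ 1 + ε) := by
          refine (hyx t ht).trans ?_
          have hℓ0 : 0 ≤ ℓ s :=
            intervalIntegral.integral_nonneg hs0 fun _ _ => norm_nonneg _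
          refine mul_le_mul_of_nonneg_left ?_ (by positivity)
          refine (mul_le_of_le_one_left (by positivity) (hexp t ht.1)).trans ?_
          have := hℓ_mono s 1 (by linarith)
          nlinarith
        linarith [hC t ht]
      obtain ⟨z, hza, hz, hzy⟩ := hnear a b ha hab le_rfl y hy hyR (γ s') (by rw [hya]; exact hc2)
      refine ⟨z, hza, hz, fun t ht => ?_⟩
      have h1 : ‖z t - y t‖ ≤ (√m)⁻¹ * (Real.exp ((ρ + ε) * (t - a)) *
          ((∫ r in s..s', ‖A r (deriv γ r)‖) + ε * (s' - s))) := by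
        refine (H.norm_le (y t) (ha.trans ht.1) _).trans ?_
        gcongr
        refine (hzy t ht).trans ?_
        gcongr
        rw [hya]
        exact hc1
      calc ‖x t - z t‖ = ‖(x t - y t) - (z t - y t)‖ := by congr 1; abel
        _ ≤ ‖x t - y t‖ + ‖z t - y t‖ := norm_sub_le _ _
        _ ≤ _ := add_le_add (hyx t ht) h1
        _ = _ := by rw [hℓ_sub s s']; ring
  obtain ⟨y, hya, hy, hyx⟩ := key (N + 1) le_rfl
  have h1 : ((N + 1 : ℕ) : ℝ) / (N + 1) = 1 := by push_cast; exact div_self hN0.ne'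
  rw [h1] at hya hyx
  refine ⟨y, hya, hy, ?_⟩
  rw [← hℓ1]
  simpa using hyx b (right_mem_Icc.2 hab)

/-! ### Global existence -/

/-- Near any time, solutions exist from all initial conditions on a common time interval. -/
lemma exists_solution_local (H : IsContracting g Θ m ρ) {T : ℝ} (hT : 0 ≤ T) :
    ∃ δ > 0, ∀ a b, 0 ≤ a → T - δ ≤ a → a ≤ b → b ≤ T + δ → ∀ x₀,
      ∃ y, y a = x₀ ∧ IsSolutionOn g a b y := by
  have hTmem : T ∈ Icc (max 0 (T - 1)) (T + 1) :=
    ⟨max_le hT (by linarith), by linarith⟩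
  -- Reference curve through 0 at time `T`: near `T` it stays in the unit ball and is a solution.
  obtain ⟨z, hz0, hzc, hz⟩ := exists_solution_in_ball H.contDiffOn_field (le_max_left _ _)
    hTmem 1 0
  obtain ⟨δ, hδ, h⟩ := Metric.continuousWithinAt_iff.1 (hzc T hTmem) 1 one_pos
  refine ⟨min (δ / 2) 1, by positivity, fun a b ha haT hab hbT x₀ => ?_⟩
  have hδ1 := min_le_left (δ / 2) 1
  have hδ2 := min_le_right (δ / 2) 1
  have hsub : Icc a b ⊆ Icc (max 0 (T - 1)) (T + 1) :=
    Icc_subset_Icc (max_le ha (by linarith)) (by linarith)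
  have hzsol : IsSolutionOn g a b z := by
    intro t ht
    refine (hz t (hsub ht) ?_).mono hsub
    have h1 := h (hsub ht) (by
      rw [Real.dist_eq, abs_lt]
      constructor <;> linarith [ht.1, ht.2])
    rw [hz0, dist_zero_right] at h1
    exact h1.le
  -- Only existence is used, so the extreme choice `ε = -ρ` suffices.
  obtain ⟨y, hya, hy, -⟩ := H.exists_solution_of_path (ε := -ρ) (by linarith [H.rate_neg])
    (by simp) ha hab hzsol (γ := fun s => z a + s • (x₀ - z a)) (by fun_prop) (by simp)
  exact ⟨y, by simpa using hya, hy⟩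

/-- The local time step does not depend on the state, so a solution reaching close to the supremal
time extends beyond it. -/
lemma exists_isSolutionOn (H : IsContracting g Θ m ρ) {a : ℝ} (ha : 0 ≤ a) (b : ℝ)
    (x₀ : E n) : ∃ y, y a = x₀ ∧ IsSolutionOn g a b y := by
  by_contra hcon
  set S : Set ℝ := {c | a ≤ c ∧ ∃ y, y a = x₀ ∧ IsSolutionOn g a c y} with hS
  have haS : a ∈ S := by
    refine ⟨le_rfl, ?_⟩
    obtain ⟨δ, hδ, h⟩ := H.exists_solution_local ha
    exact h a a ha (by linarith) le_rfl (by linarith) x₀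
  have hub : ∀ c ∈ S, c ≤ b := by
    rintro c ⟨-, y, hya, hy⟩
    by_contra! hlt
    exact hcon ⟨y, hya, hy.mono le_rfl hlt.le⟩
  have hbdd : BddAbove S := ⟨b, hub⟩
  have haT : a ≤ sSup S := le_csSup hbdd haS
  obtain ⟨δ, hδ, h⟩ := H.exists_solution_local (ha.trans haT)
  obtain ⟨c, ⟨hac, y, hya, hy⟩, hcT⟩ := exists_lt_of_lt_csSup ⟨a, haS⟩
    (show sSup S - δ < sSup S by linarith)
  have hcle : c ≤ sSup S := le_csSup hbdd ⟨hac, y, hya, hy⟩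
  obtain ⟨z, hzc, hz⟩ := h c (sSup S + δ) (ha.trans hac) hcT.le (by linarith) le_rfl (y c)
  have hmem : sSup S + δ ∈ S := by
    refine ⟨by linarith, _, ?_, hy.glue hac (by linarith) hz hzc.symm⟩
    simp [hac, hya]
  linarith [le_csSup hbdd hmem]

/-- Uniqueness makes the solutions on growing intervals agree, so their diagonal is a trajectory. -/
lemma exists_isTrajectory (H : IsContracting g Θ m ρ) {a : ℝ} (ha : 0 ≤ a) (x₀ : E n) :
    ∃ x, IsTrajectory g a x ∧ x a = x₀ := by
  choose X hXa hX using fun b => H.exists_isSolutionOn ha b x₀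
  refine ⟨fun t => X t t, isTrajectory_of_forall_isSolutionOn fun b => ?_, hXa a⟩
  refine (hX b).congr fun t ht => ?_
  exact (hX t).eqOn H.contDiffOn_field ha ((hX b).mono le_rfl ht.2)
    ((hXa t).trans (hXa b).symm) (right_mem_Icc.2 ht.1)

/-! ### Exponential convergence -/

/-- By uniqueness the solution transported along `γ` is `y`; then ε → 0. -/
lemma norm_sub_le_pathLength (H : IsContracting g Θ m ρ) {a b : ℝ} (ha : 0 ≤ a) (hab : a ≤ b)
    {x y : ℝ → E n} (hx : IsSolutionOn g a b x) (hy : IsSolutionOn g a b y) {γ : ℝ → E n}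
    (hγ : ContDiff ℝ 1 γ) (hγ0 : γ 0 = x a) (hγ1 : γ 1 = y a) :
    ‖x b - y b‖ ≤ (√m)⁻¹ * (Real.exp (ρ * (b - a)) * pathLength Θ a γ) := by
  have h1 : ∀ᶠ ε in 𝓝[>] (0 : ℝ), ‖x b - y b‖ ≤
      (√m)⁻¹ * (Real.exp ((ρ + ε) * (b - a)) * (pathLength Θ a γ + ε)) := by
    filter_upwards [Ioo_mem_nhdsGT (neg_pos.2 H.rate_neg)] with ε hε
    obtain ⟨z, hza, hz, h⟩ := H.exists_solution_of_path hε.1 (by linarith [hε.2]) ha hab hx hγ hγ0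
    rwa [hz.eqOn H.contDiffOn_field ha hy (hza.trans hγ1) (right_mem_Icc.2 hab)] at h
  have h2 : Tendsto (fun ε : ℝ => (√m)⁻¹ *
      (Real.exp ((ρ + ε) * (b - a)) * (pathLength Θ a γ + ε))) (𝓝[>] 0)
      (𝓝 ((√m)⁻¹ * (Real.exp ((ρ + 0) * (b - a)) * (pathLength Θ a γ + 0)))) := by
    refine tendsto_nhdsWithin_of_tendsto_nhds (Continuous.tendsto ?_ 0)
    fun_prop
  rw [add_zero, add_zero] at h2
  exact ge_of_tendsto h2 h1

lemma norm_sub_le_pathDist (H : IsContracting g Θ m ρ) {a b : ℝ} (ha : 0 ≤ a) (hab : a ≤ b)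
    {x y : ℝ → E n} (hx : IsSolutionOn g a b x) (hy : IsSolutionOn g a b y) :
    ‖x b - y b‖ ≤ (√m)⁻¹ * pathDist Θ a (x a) (y a) * Real.exp (ρ * (b - a)) := by
  have hc : 0 < (√m)⁻¹ * Real.exp (ρ * (b - a)) :=
    mul_pos (inv_pos.2 (Real.sqrt_pos.2 H.m_pos)) (Real.exp_pos _)
  have h1 : ‖x b - y b‖ / ((√m)⁻¹ * Real.exp (ρ * (b - a))) ≤ pathDist Θ a (x a) (y a) := by
    refine le_csInf ⟨_, fun s => x a + s • (y a - x a), by fun_prop, by simp, by simp, rfl⟩ ?_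
    rintro L ⟨γ, hγ, hγ0, hγ1, rfl⟩
    rw [div_le_iff₀ hc]
    exact (H.norm_sub_le_pathLength ha hab hx hy hγ hγ0 hγ1).trans_eq (by ring)
  rw [div_le_iff₀ hc] at h1
  exact h1.trans_eq (by ring)

end IsContracting

end Contraction

theorem mainTheorem7 (n k : ℕ) (hn : 0 < n)
    (f : Contraction.E n → Contraction.E k → ℝ → Contraction.E n)
    (u : Contraction.E n → ℝ → Contraction.E k)
    (Θ : Contraction.E n → ℝ → (Contraction.E n →L[ℝ] Contraction.E n))
    (hf : ContDiffOn ℝ 1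
      (fun p : Contraction.E n × ℝ => Contraction.closedLoop f u p.1 p.2) (Contraction.domain n))
    (hΘ : ContDiffOn ℝ 1
      (fun p : Contraction.E n × ℝ => Θ p.1 p.2) (Contraction.domain n))
    (m : ℝ) (hm : 0 < m)
    (hM : ∀ x t, 0 ≤ t →
      m • ContinuousLinearMap.id ℝ (Contraction.E n) ≤ Contraction.metric Θ x t)
    (lam : ℝ) (hlam : 0 < lam)
    (hF : ∀ x t, 0 ≤ t →
      Contraction.symPart (Contraction.genJacobian (Contraction.closedLoop f u) Θ x t) ≤
        (-lam) • ContinuousLinearMap.id ℝ (Contraction.E n)) :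
    -- the exponent is negative: it is at most `-lam`
    Contraction.convergenceExponent (Contraction.closedLoop f u) Θ ≤ -lam ∧
    -- every initial condition has a trajectory defined for all later times
    (∀ t₀ : ℝ, 0 ≤ t₀ → ∀ x₀ : Contraction.E n,
      ∃ x : ℝ → Contraction.E n,
        Contraction.IsTrajectory (Contraction.closedLoop f u) t₀ x ∧ x t₀ = x₀) ∧
    -- all trajectories converge exponentially to a single trajectory
    (∃ xs : ℝ → Contraction.E n, Contraction.IsTrajectory (Contraction.closedLoop f u) 0 xs ∧
      ∀ t₀ : ℝ, 0 ≤ t₀ → ∀ x : ℝ → Contraction.E n,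
        Contraction.IsTrajectory (Contraction.closedLoop f u) t₀ x →
        ∃ C : ℝ, ∀ t, t₀ ≤ t →
          ‖x t - xs t‖ ≤
            C * Real.exp (Contraction.convergenceExponent (Contraction.closedLoop f u) Θ
              * (t - t₀))) ∧
    -- any two trajectories converge to each other, with the constant given by the initial
    -- distance in the metric
    (∀ t₀ : ℝ, 0 ≤ t₀ → ∀ x y : ℝ → Contraction.E n,
      Contraction.IsTrajectory (Contraction.closedLoop f u) t₀ x →
      Contraction.IsTrajectory (Contraction.closedLoop f u) t₀ y →
      ∀ t, t₀ ≤ t →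
        ‖x t - y t‖ ≤
          (Real.sqrt m)⁻¹ * Contraction.pathDist Θ t₀ (x t₀) (y t₀) *
            Real.exp (Contraction.convergenceExponent (Contraction.closedLoop f u) Θ
              * (t - t₀))) := by
  have hρ := Contraction.convergenceExponent_le hn hF
  have H : Contraction.IsContracting (Contraction.closedLoop f u) Θ m
      (Contraction.convergenceExponent (Contraction.closedLoop f u) Θ) :=
    { contDiffOn_field := hf
      contDiffOn_theta := hΘ
      m_pos := hm
      rate_neg := by linarith
      le_norm_theta := fun x t ht => Contraction.le_norm_of_smul_id_le_metric hm (hM x t ht)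
      inner_genJacobian_le := fun x t ht =>
        Contraction.inner_genJacobian_le_convergenceExponent hn hF x ht }
  have hdist : ∀ t₀ : ℝ, 0 ≤ t₀ → ∀ x y : ℝ → Contraction.E n,
      Contraction.IsTrajectory (Contraction.closedLoop f u) t₀ x →
      Contraction.IsTrajectory (Contraction.closedLoop f u) t₀ y →
      ∀ t, t₀ ≤ t → ‖x t - y t‖ ≤
        (Real.sqrt m)⁻¹ * Contraction.pathDist Θ t₀ (x t₀) (y t₀) *
          Real.exp (Contraction.convergenceExponent (Contraction.closedLoop f u) Θ
            * (t - t₀)) := fun t₀ ht₀ x y hx hy t ht =>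
    H.norm_sub_le_pathDist ht₀ ht (hx.isSolutionOn t) (hy.isSolutionOn t)
  refine ⟨hρ, fun t₀ ht₀ x₀ => H.exists_isTrajectory ht₀ x₀, ?_, hdist⟩
  -- Any trajectory can serve as the common limit; this one starts at the origin.
  obtain ⟨xs, hxs, -⟩ := H.exists_isTrajectory le_rfl 0
  exact ⟨xs, hxs, fun t₀ ht₀ x hx => ⟨_, hdist t₀ ht₀ x xs hx (hxs.mono ht₀)⟩⟩
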